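/- Let $(W,S)$ be a Coxeter system with Coxeter graph $\Gamma$ (the set $S$ and the group $W$ may be infinite, and labels $\infty$ are allowed). Let $X_\Gamma=\{wsw^{-1} : w\in W,\ s\in S\}$ be its Coxeter quandle, that is, the set of reflections of $W$ with the operation $x\lhd y=y^{-1}xy$. The adjoint group $\mathrm{As}(X_\Gamma)=\langle e_x\ (x\in X_\Gamma)\mid e_{x\lhd y}=e_y^{-1}e_xe_y\ (x,y\in X_\Gamma)\rangle$ acts on $X_\Gamma$ from the right by $x\cdot e_y=x\lhd y$. If $X_\Gamma$ is connected, i.e. if this action is transitive, then the second homology group $H_2^{\mathrm{gr}}(W)=H_2(W;\mathbb Z)$ with trivial integral coefficients is annihilated by $2$: $2a=0$ for every $a\in H_2^{\mathrm{gr}}(W)$. -/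

import Mathlib

universe u v

/-- The Coxeter quandle of a Coxeter system: the set of reflections, i.e. of the elements of `W`
that are conjugate to a simple generator. -/
def CoxeterQuandle {B : Type v} {M : CoxeterMatrix B} {W : Type u} [Group W]
    (cs : CoxeterSystem M W) : Type u :=
  {t : W // cs.IsReflection t}

/-- The conjugation operation on reflections. In Mathlib's convention for quandles the acting
element stands on the left: `act t t'` is the element written `t' ◁ t` in the convention for
right quandles, and equals `t * t' * t⁻¹ = t⁻¹ * t' * t` since `t` is an involution. -/
instance CoxeterQuandle.instQuandle {B : Type v} {M : CoxeterMatrix B} {W : Type u} [Group W]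
    (cs : CoxeterSystem M W) : Quandle (CoxeterQuandle cs) where
  act t t' := ⟨t.1 * t'.1 * t.1⁻¹, t'.2.conj t.1⟩
  self_distrib := by
    intro x y z
    apply Subtype.ext
    simp [mul_assoc]
  invAct t t' := ⟨t.1⁻¹ * t'.1 * t.1, by simpa using t'.2.conj t.1⁻¹⟩
  left_inv t t' := by
    apply Subtype.ext
    simp [mul_assoc]
  right_inv t t' := by
    apply Subtype.ext
    simp [mul_assoc]
  fix := by
    intro x
    apply Subtype.ext
    simp

/-- A quandle is connected if its adjoint group (enveloping group: one generator for each element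
of `X`, with the conjugation relations) acts transitively on it. -/
def QuandleIsConnected (X : Type u) [Quandle X] : Prop :=
  ∀ x y : X, ∃ g : Rack.EnvelGroup X, Rack.envelAction g x = y

/-- The homology `H_n(G; ℤ)` of a group `G` with trivial integral coefficients. Mathlib wants the
coefficient ring in the universe of `G`, so `ℤ` is lifted to that universe. -/
noncomputable abbrev integralGroupHomology (G : Type u) [Group G] (n : ℕ) :
    ModuleCat.{u} (ULift.{u} ℤ) :=
  groupHomology (Rep.trivial (ULift.{u} ℤ) G (ULift.{u} ℤ)) n

/-! Let `c` be a 2-cocycle of a Coxeter group `W` with values in a trivial module. In the extension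
`E` of `W` defined by `2 • c`, involutions of `W` lift to involutions, and every element of `E` over
the centralizer of an involution `s` commutes with the lifts of `s`, because the commutator pairing
of `c` takes values of order at most two on such pairs. Hence `E → W` is injective on conjugacy
classes of lifts of involutions. Lifting the simple reflections to involutions that are conjugate
whenever the reflections are, one reads off each relation `(s * t) ^ m = 1` from a conjugation:
with `m = 2 * k` or `m = 2 * k + 1`, conjugation by `(s * t) ^ k` fixes `s` or takes `s` to `t`. So
the extension splits and `2 • c` is a coboundary.

Applied to the universal 2-cocycle, whose values are maps into 2-chains modulo 2-boundaries, this
yields `2 • H₂ = 0`. -/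

section InvolutionLifts

variable {E G : Type*} [Group E] [Group G]

theorem mul_pow_mul_mul_inv_of_mul_self {a b : G} (ha : a * a = 1) (hb : b * b = 1) (k : ℕ) :
    (a * b) ^ k * a * ((a * b) ^ k)⁻¹ = (a * b) ^ (2 * k) * a := by
  have hinv : (a * b)⁻¹ = b * a := by
    rw [mul_inv_rev, inv_eq_of_mul_eq_one_right ha, inv_eq_of_mul_eq_one_right hb]
  have hsemi : SemiconjBy a (b * a) (a * b) := (mul_assoc a b a).symm
  calc (a * b) ^ k * a * ((a * b) ^ k)⁻¹ = (a * b) ^ k * (a * (b * a) ^ k) := by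
        rw [← inv_pow, hinv, mul_assoc]
    _ = (a * b) ^ (2 * k) * a := by rw [(hsemi.pow_right k).eq, ← mul_assoc, ← pow_add, two_mul]

theorem mul_self_eq_one_of_isConj {a b : G} (hab : IsConj a b) (ha : a * a = 1) : b * b = 1 := by
  simpa only [pow_two, ha, isConj_one_right] using hab.pow 2

theorem exists_isConj_map_eq {π : E →* G} (hπ : Function.Surjective π) {x : E} {t : G}
    (h : IsConj (π x) t) : ∃ y, IsConj x y ∧ π y = t := by
  obtain ⟨g, rfl⟩ := isConj_iff.1 h
  obtain ⟨y, rfl⟩ := hπ g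
  exact ⟨y * x * y⁻¹, isConj_iff.2 ⟨y, rfl⟩, by simp only [map_mul, map_inv]⟩

theorem exists_rightInverse_isConj {π : E →* G} (hπ : Function.Surjective π) {l : G → E}
    (hl : Function.RightInverse l π) :
    ∃ r : G → E, Function.RightInverse r π ∧ (∀ s, ∃ t, IsConj s t ∧ IsConj (l t) (r s)) ∧
      ∀ s t, IsConj s t → IsConj (r s) (r t) := by
  let rep (s : G) : G := (ConjClasses.mk s).out
  have hrep (s : G) : IsConj (rep s) s := ConjClasses.mk_eq_mk_iff_isConj.1 (Quotient.out_eq _)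
  have hlift (s : G) : ∃ x, IsConj (l (rep s)) x ∧ π x = s :=
    exists_isConj_map_eq hπ (by rw [hl]; exact hrep s)
  choose r hlr hr using hlift
  refine ⟨r, hr, fun s => ⟨rep s, (hrep s).symm, hlr s⟩, fun s t hst => ?_⟩
  have hst' : rep s = rep t := congrArg Quotient.out (ConjClasses.mk_eq_mk_iff_isConj.2 hst)
  exact (hlr s).symm.trans (hst' ▸ hlr t)

theorem injOn_conjugatesOf_of_commute {π : E →* G} {e : E}
    (he : ∀ x, Commute (π e) (π x) → Commute e x) : Set.InjOn π (conjugatesOf e) := by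
  intro x hx y hy hxy
  obtain ⟨g, rfl⟩ := isConj_iff.1 hx
  obtain ⟨h, rfl⟩ := isConj_iff.1 hy
  simp only [map_mul, map_inv] at hxy
  have hcomm : Commute e (h⁻¹ * g) := he _ <| by
    simp only [map_mul, map_inv]
    calc π e * ((π h)⁻¹ * π g) = (π h)⁻¹ * (π h * π e * (π h)⁻¹) * π g := by group
      _ = (π h)⁻¹ * π g * π e := by rw [← hxy]; group
  calc g * e * g⁻¹ = h * (h⁻¹ * g * e) * g⁻¹ := by group
    _ = h * e * h⁻¹ := by rw [← hcomm.eq]; group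

theorem mul_pow_eq_one_of_injOn_conjugatesOf {π : E →* G} {a b : E} (ha : a * a = 1)
    (hb : b * b = 1) (hinj : Set.InjOn π (conjugatesOf a))
    (hconj : IsConj (π a) (π b) → IsConj a b) {m : ℕ} (hm : (π a * π b) ^ m = 1) :
    (a * b) ^ m = 1 := by
  have hπa : π a * π a = 1 := by rw [← map_mul, ha, map_one]
  have hπb : π b * π b = 1 := by rw [← map_mul, hb, map_one]
  obtain ⟨k, rfl | rfl⟩ := Nat.even_or_odd' m
  all_goals
    have hmem : (a * b) ^ k * a * ((a * b) ^ k)⁻¹ ∈ conjugatesOf a := isConj_iff.2 ⟨_, rfl⟩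
    have hmap := mul_pow_mul_mul_inv_of_mul_self hπa hπb k
  · have h : (a * b) ^ k * a * ((a * b) ^ k)⁻¹ = a :=
      hinj hmem mem_conjugatesOf_self (by simp only [map_mul, map_pow, map_inv, hmap, hm, one_mul])
    rwa [mul_pow_mul_mul_inv_of_mul_self ha hb, mul_eq_right] at h
  · rw [pow_succ, ← mul_assoc, mul_eq_one_iff_eq_inv, inv_eq_of_mul_eq_one_right hπb] at hm
    rw [hm] at hmap
    have h : (a * b) ^ k * a * ((a * b) ^ k)⁻¹ = b :=
      hinj hmem (hconj (isConj_iff.2 ⟨_, hmap⟩)) (by simp only [map_mul, map_pow, map_inv, hmap])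
    rw [mul_pow_mul_mul_inv_of_mul_self ha hb] at h
    rw [pow_succ, ← mul_assoc, h, hb]

theorem exists_comp_eq_id_of_involutions_lift {B : Type*} {M : CoxeterMatrix B}
    (cs : CoxeterSystem M G) {π : E →* G} (hπ : Function.Surjective π)
    (hlift : ∀ s, s * s = 1 → ∃ e, π e = s ∧ e * e = 1)
    (hcomm : ∀ x y, π x * π x = 1 → Commute (π x) (π y) → Commute x y) :
    ∃ σ : G →* E, π.comp σ = MonoidHom.id G := by
  have hlift' (s : G) : ∃ e, π e = s ∧ (s * s = 1 → e * e = 1) := by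
    by_cases hs : s * s = 1
    · exact (hlift s hs).imp fun _ he => ⟨he.1, fun _ => he.2⟩
    · exact (hπ s).imp fun _ he => ⟨he, fun h => absurd h hs⟩
  choose l hl hll using hlift'
  obtain ⟨r, hr, hlr, hconj⟩ := exists_rightInverse_isConj hπ hl
  have hrr (i : B) : r (cs.simple i) * r (cs.simple i) = 1 := by
    obtain ⟨t, hst, hlt⟩ := hlr (cs.simple i)
    exact mul_self_eq_one_of_isConj hlt
      (hll t (mul_self_eq_one_of_isConj hst (cs.simple_mul_simple_self i)))
  have hinj (i : B) : Set.InjOn π (conjugatesOf (r (cs.simple i))) :=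
    injOn_conjugatesOf_of_commute fun x => hcomm _ x (by rw [hr, cs.simple_mul_simple_self])
  have hrel : M.IsLiftable (r ∘ cs.simple) := fun i j =>
    mul_pow_eq_one_of_injOn_conjugatesOf (hrr i) (hrr j) (hinj i)
      (by simpa only [hr _] using hconj _ _) (by simp only [hr _, cs.simple_mul_simple_pow])
  refine ⟨cs.lift ⟨_, hrel⟩, cs.ext_simple fun i => ?_⟩
  rw [MonoidHom.comp_apply, cs.lift_apply_simple hrel, Function.comp_apply, hr, MonoidHom.id_apply]

end InvolutionLifts

section CocycleExtension

open groupCohomology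

variable {k G : Type u} [CommRing k] [Group G] {A : Rep.{u} k G}

/-- The extension of `G` by `A` defined by a 2-cocycle `c`, that is, `A × G` with multiplication
`(a, g) * (b, h) = (a + g • b + c (g, h), g * h)`. As `c` need not be normalized, the identity is
`(-c (1, 1), 1)`. -/
@[ext]
structure CocycleExtension (c : cocycles₂ A) where
  /-- The component in the kernel. -/
  left : A
  /-- The component in the quotient. -/
  right : G

namespace CocycleExtension

variable {c : cocycles₂ A}

instance : Mul (CocycleExtension c) :=
  ⟨fun x y => ⟨x.left + A.ρ x.right y.left + c (x.right, y.right), x.right * y.right⟩⟩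

instance : One (CocycleExtension c) := ⟨⟨-c (1, 1), 1⟩⟩

instance : Inv (CocycleExtension c) :=
  ⟨fun x => ⟨-A.ρ x.right⁻¹ x.left - c (x.right⁻¹, x.right) - c (1, 1), x.right⁻¹⟩⟩

@[simp] theorem mul_left (x y : CocycleExtension c) :
    (x * y).left = x.left + A.ρ x.right y.left + c (x.right, y.right) := rfl

@[simp] theorem mul_right (x y : CocycleExtension c) : (x * y).right = x.right * y.right := rfl

@[simp] theorem one_left : (1 : CocycleExtension c).left = -c (1, 1) := rfl

@[simp] theorem one_right : (1 : CocycleExtension c).right = 1 := rfl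

@[simp] theorem inv_left (x : CocycleExtension c) :
    x⁻¹.left = -A.ρ x.right⁻¹ x.left - c (x.right⁻¹, x.right) - c (1, 1) := rfl

@[simp] theorem inv_right (x : CocycleExtension c) : x⁻¹.right = x.right⁻¹ := rfl

instance : Group (CocycleExtension c) :=
  Group.ofLeftAxioms
    (fun x y z => by
      ext
      · have hc := (mem_cocycles₂_iff c.1).1 c.2 x.right y.right z.right
        simp only [cocycles₂.val_eq_coe] at hc
        simp only [mul_left, mul_right, map_add, map_mul, Module.End.mul_apply]
        linear_combination (norm := module) hc
      · exact mul_assoc _ _ _)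
    (fun x => by ext <;> simp [cocycles₂_map_one_fst])
    (fun x => by
      ext
      · simp only [mul_left, inv_left, inv_right, one_left]
        abel
      · simp)

variable (c) in
/-- The projection of the extension onto its quotient. -/
def rightHom : CocycleExtension c →* G where
  toFun := right
  map_one' := rfl
  map_mul' _ _ := rfl

theorem rightHom_surjective : Function.Surjective (rightHom c) := fun g => ⟨⟨0, g⟩, rfl⟩

theorem mem_coboundaries₂_of_rightHom_comp_eq_id {σ : G →* CocycleExtension c}
    (hσ : (rightHom c).comp σ = MonoidHom.id G) : (c : G × G → A) ∈ coboundaries₂ A := by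
  have hright (g : G) : (σ g).right = g := DFunLike.congr_fun hσ g
  refine ⟨fun g => -(σ g).left, funext fun ⟨g, h⟩ => ?_⟩
  have hmul : (σ (g * h)).left = (σ g).left + A.ρ g (σ h).left + c (g, h) := by
    rw [map_mul, mul_left, hright, hright]
  simp only [d₁₂_hom_apply, map_neg, hmul]
  abel

variable [A.IsTrivial]

theorem exists_rightHom_eq_and_mul_self_eq_one (c : cocycles₂ A) {s : G} (hs : s * s = 1) :
    ∃ e, rightHom ((2 : k) • c) e = s ∧ e * e = 1 := by
  refine ⟨⟨-c (s, s) - c (1, 1), s⟩, rfl, ?_⟩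
  have hss : ((2 : k) • c) (s, s) = (2 : k) • c (s, s) := rfl
  have h11 : ((2 : k) • c) (1, 1) = (2 : k) • c (1, 1) := rfl
  ext
  · simp only [mul_left, one_left, Representation.isTrivial_apply, hss, h11]
    module
  · exact hs

end CocycleExtension

theorem two_smul_cocycles₂_comm [A.IsTrivial] (c : cocycles₂ A) {s g : G} (hs : s * s = 1)
    (hsg : Commute s g) : (2 : k) • c (s, g) = (2 : k) • c (g, s) := by
  have hc (x y z : G) : c (x * y, z) + c (x, y) = c (y, z) + c (x, y * z) := by
    simpa only [Representation.isTrivial_apply] using (mem_cocycles₂_iff c).1 c.2 x y z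
  have hssg := hc s s g
  have hsgs := hc s g s
  have hgss := hc g s s
  rw [hs, cocycles₂_map_one_fst] at hssg
  rw [hs, cocycles₂_map_one_snd, Representation.isTrivial_apply] at hgss
  rw [hsg.eq] at hssg hsgs
  linear_combination (norm := module) hsgs - hssg - hgss

theorem two_smul_cocycle_mem_coboundaries₂ {B : Type v} {M : CoxeterMatrix B}
    (cs : CoxeterSystem M G) [A.IsTrivial] (c : cocycles₂ A) :
    (2 : k) • (c : G × G → A) ∈ coboundaries₂ A := by
  obtain ⟨σ, hσ⟩ := exists_comp_eq_id_of_involutions_lift cs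
    CocycleExtension.rightHom_surjective
    (fun _ hs => CocycleExtension.exists_rightHom_eq_and_mul_self_eq_one c hs)
    (fun x y hx hxy => by
      ext
      · simp only [CocycleExtension.mul_left, Representation.isTrivial_apply]
        rw [add_comm x.left]
        exact congrArg _ (two_smul_cocycles₂_comm c hx hxy)
      · exact hxy)
  exact CocycleExtension.mem_coboundaries₂_of_rightHom_comp_eq_id hσ

end CocycleExtension

section UniversalCocycle

open groupHomology

variable {k G : Type u} [CommRing k] [Group G] (A : Rep.{u} k G)

/-- The `G`-module of `k`-linear maps from `A` to the trivial module of 2-chains modulo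
2-boundaries. -/
noncomputable abbrev chainsQuotientHom : Rep.{u} k G :=
  Rep.of (A.ρ.linHom (Representation.trivial k G ((G × G →₀ A) ⧸ boundaries₂ A)))

instance [A.IsTrivial] : (chainsQuotientHom A).IsTrivial where
  out g := by
    ext f a
    simp [chainsQuotientHom]

/-- The universal 2-cocycle, sending `(g, h)` to `a ↦ [a · (g, h)]`. A scalar that makes it a
coboundary annihilates `H₂(G, A)`. -/
noncomputable def universalCocycle : groupCohomology.cocycles₂ (chainsQuotientHom A) :=
  ⟨fun g => (boundaries₂ A).mkQ ∘ₗ Finsupp.lsingle g, by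
    refine (groupCohomology.mem_cocycles₂_def _).2 fun g h j => ?_
    ext a
    have hd : (boundaries₂ A).mkQ (d₃₂ A (Finsupp.single (g, h, j) a)) = 0 :=
      (Submodule.Quotient.mk_eq_zero _).2 ⟨_, rfl⟩
    rw [d₃₂_single (G := G), map_sub, map_add, map_sub] at hd
    exact hd⟩

variable {A}

theorem smul_H2_eq_zero {r : k}
    (hr : (r • universalCocycle A : G × G → chainsQuotientHom A) ∈
      groupCohomology.coboundaries₂ (chainsQuotientHom A)) (x : H2 A) : r • x = 0 := by
  induction x using H2_induction_on with | h z
  obtain ⟨f, hf⟩ := hr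
  let F : (G →₀ A) →ₗ[k] (G × G →₀ A) ⧸ boundaries₂ A := Finsupp.lsum k f
  have hF : F ∘ₗ (d₂₁ A).hom = r • (boundaries₂ A).mkQ := by
    ext g a : 2
    calc F (d₂₁ A (Finsupp.single g a))
        = f g.2 (A.ρ g.1⁻¹ a) - f (g.1 * g.2) a + f g.1 a := by
          rw [d₂₁_single (G := G), map_add, map_sub]
          simp only [F, Finsupp.lsum_single]
      _ = r • (boundaries₂ A).mkQ (Finsupp.single g a) := LinearMap.congr_fun (congrFun hf g) a
  rw [← map_smul, H2π_eq_zero_iff, ← Submodule.Quotient.mk_eq_zero]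
  calc (boundaries₂ A).mkQ (r • z.1) = F (d₂₁ A z.1) := (LinearMap.congr_fun hF z.1).symm
    _ = 0 := by rw [show d₂₁ A z.1 = 0 from z.2, map_zero]

end UniversalCocycle

theorem theorem4p10_general {k W : Type u} [CommRing k] [Group W] {B : Type v}
    {M : CoxeterMatrix B} (cs : CoxeterSystem M W) (A : Rep.{u} k W) [A.IsTrivial]
    (a : groupHomology A 2) : (2 : ℕ) • a = 0 := by
  rw [two_nsmul, ← two_smul k]
  exact smul_H2_eq_zero (two_smul_cocycle_mem_coboundaries₂ cs _) a

theorem theorem4p10 {B : Type v} {M : CoxeterMatrix B} {W : Type u} [Group W]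
    (cs : CoxeterSystem M W) (hX : QuandleIsConnected (CoxeterQuandle cs))
    (a : integralGroupHomology W 2) :
    (2 : ℕ) • a = 0 :=
  theorem4p10_general cs _ a
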